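/- For positive integers $k_1\ge 2$, $k_2\ge 1$ and $a_1,a_2\in\{0,1\}$, consider the alternating double zeta values $$\sum_{m_1>m_2>0}\frac{(-1)^{a_1m_1+a_2m_2}}{m_1^{k_1}m_2^{k_2}},$$ where $m_1,m_2$ are integers. The value is denoted by $\zeta(k_1,k_2)$ if $(a_1,a_2)=(0,0)$, by $\zeta^{(2)}(k_1,\overline{k_2})$ if $(a_1,a_2)=(0,1)$, by $\zeta^{(2)}(\overline{k_1},k_2)$ if $(a_1,a_2)=(1,0)$, and by $\zeta^{(2)}(\overline{k_1},\overline{k_2})$ if $(a_1,a_2)=(1,1)$. For $k\ge 2$ put $\zeta^{(2)}(\overline{k})=\sum_{m\ge 1}\frac{(-1)^m}{m^k}$, and let $\zeta$ (with one argument) be the Riemann zeta function, $\zeta(k)=\sum_{m\ge 1}\frac{1}{m^k}$. Then for every integer $k\geq 3$ all the series occurring below converge absolutely, and $$\sum_{j=2}^{k-1}2^j\zeta(j,k-j)=(k+1)\zeta(k),$$ $$\sum_{j=2}^{k-1}2^j\zeta^{(2)}(j,\overline{k-j})+\sum_{j=2}^{k-1}2^j\zeta^{(2)}(\overline{j},\overline{k-j})=2\zeta(k)+2k\,\zeta^{(2)}(\overline{k}),$$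 $$\sum_{j=2}^{k-1}2^j\zeta^{(2)}(\overline{j},k-j)=(k-1)\zeta(k)+2\,\zeta^{(2)}(\overline{k}).$$ -/

import Mathlib

/-- The general term `(-1)^(a m) / m^k` of the alternating zeta series, for `m ≥ 1`.
The index `a = 1` means that the argument `k` is barred, `a = 0` that it is not. -/
noncomputable def altZetaTerm (k : ℕ) (a : ZMod 2) (m : ℕ+) : ℂ :=
  (-1 : ℂ) ^ (a.val * (m : ℕ)) / (m : ℂ) ^ k

/-- The alternating zeta value `∑_{m > 0} (-1)^(a m) / m^k`, for `k ≥ 2`. -/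
noncomputable def altZeta (k : ℕ) (a : ZMod 2) : ℂ :=
  ∑' m : ℕ+, altZetaTerm k a m

/-- The pairs `(m₁, m₂)` of natural numbers with `m₁ > m₂ > 0`. -/
abbrev DecreasingPair : Type := {m : ℕ × ℕ // 0 < m.2 ∧ m.2 < m.1}

/-- The general term `(-1)^(a₁ m₁ + a₂ m₂) / (m₁^k₁ m₂^k₂)` of the alternating double zeta
series. The index `aᵢ = 1` means that the argument `kᵢ` is barred, `aᵢ = 0` that it is not. -/
noncomputable def altDoubleZetaTerm (k₁ k₂ : ℕ) (a₁ a₂ : ZMod 2) (m : DecreasingPair) : ℂ :=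
  (-1 : ℂ) ^ (a₁.val * m.1.1 + a₂.val * m.1.2) / ((m.1.1 : ℂ) ^ k₁ * (m.1.2 : ℂ) ^ k₂)

/-- The alternating double zeta value
`∑_{m₁ > m₂ > 0} (-1)^(a₁ m₁ + a₂ m₂) / (m₁^k₁ m₂^k₂)`, for `k₁ ≥ 2` and `k₂ ≥ 1`
(the series is then absolutely convergent). -/
noncomputable def altDoubleZeta (k₁ k₂ : ℕ) (a₁ a₂ : ZMod 2) : ℂ :=
  ∑' m : DecreasingPair, altDoubleZetaTerm k₁ k₂ a₁ a₂ m

/-- The double zeta value `ζ(k₁, k₂) = ∑_{m₁ > m₂ > 0} 1 / (m₁^k₁ m₂^k₂)`, for `k₁ ≥ 2` and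
`k₂ ≥ 1`. -/
noncomputable def doubleZeta (k₁ k₂ : ℕ) : ℂ :=
  ∑' m : DecreasingPair, 1 / ((m.1.1 : ℂ) ^ k₁ * (m.1.2 : ℂ) ^ k₂)

open Filter Topology

/-! Put `m₁ = m + n`, `m₂ = n`, and symmetrize in `m` and `n`. The weights `2 ^ j` then give two
geometric progressions, of ratios `2n/(m+n)` and `2m/(m+n)`, whose end terms cancel
(`sum_two_pow_partialFractions`). Off the diagonal this leaves `n^(-(k-1)) * (1/(m-n) - 1/(m+n))`
plus its mirror image. This kernel is absolutely summable, so each half may be summed separately.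
For a sign `α`, the sum over `m` of `α^m * (1/(m-n) - 1/(m+n))`, without `1/(m-n)` at `m = n`,
telescopes to `1/n` whatever `α` is (`tendsto_sum_pow_mul_inv_sub`). Only single zeta values remain,
the diagonal supplying the one barred by `a + b`. The sign choices `(0,0)`, `(0,1)`, `(1,1)` in
`sum_two_pow_mul_altDoubleZeta` give the three formulas. -/

/-- The weighted sum of partial fractions on the line `x + y`, in closed form. -/
lemma sum_two_pow_partialFractions {x y : ℂ} (hx : x ≠ 0) (hy : y ≠ 0) (hxy : x + y ≠ 0)
    (hne : x - y ≠ 0) (K : ℕ) :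
    ∑ i ∈ Finset.range K, (2 : ℂ) ^ (i + 1) *
        (1 / ((x + y) ^ (i + 2) * y ^ (K - i)) + 1 / ((x + y) ^ (i + 2) * x ^ (K - i)))
      = 1 / y ^ (K + 1) * ((x - y)⁻¹ - (x + y)⁻¹)
        + 1 / x ^ (K + 1) * ((y - x)⁻¹ - (x + y)⁻¹) := by
  have hne' : y - x = -(x - y) := by ring
  rw [hne', inv_neg]
  induction K with
  | zero =>
    simp only [Finset.range_zero, Finset.sum_empty, zero_add, pow_one]
    field_simp
    ring
  | succ K ih =>
    have key : ∀ i ∈ Finset.range K, (2 : ℂ) ^ (i + 1 + 1) *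
        (1 / ((x + y) ^ (i + 1 + 2) * y ^ (K + 1 - (i + 1)))
          + 1 / ((x + y) ^ (i + 1 + 2) * x ^ (K + 1 - (i + 1)))) =
        2 / (x + y) * ((2 : ℂ) ^ (i + 1) *
        (1 / ((x + y) ^ (i + 2) * y ^ (K - i)) + 1 / ((x + y) ^ (i + 2) * x ^ (K - i)))) := by
      intro i _
      rw [Nat.add_sub_add_right]
      field_simp
      ring
    rw [Finset.sum_range_succ', Finset.sum_congr rfl key, ← Finset.mul_sum, ih]
    simp only [Nat.sub_zero, zero_add, pow_one]
    field_simp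
    ring

lemma sum_two_pow_partialFractions_diag {x : ℂ} (hx : x ≠ 0) (K : ℕ) :
    ∑ i ∈ Finset.range K, (2 : ℂ) ^ (i + 1) *
        (1 / ((x + x) ^ (i + 2) * x ^ (K - i)) + 1 / ((x + x) ^ (i + 2) * x ^ (K - i)))
      = K / x ^ (K + 2) := by
  have key : ∀ i ∈ Finset.range K, (2 : ℂ) ^ (i + 1) *
      (1 / ((x + x) ^ (i + 2) * x ^ (K - i)) + 1 / ((x + x) ^ (i + 2) * x ^ (K - i)))
        = 1 / x ^ (K + 2) := by
    intro i hi
    have hi' : i < K := Finset.mem_range.1 hi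
    have e : x ^ (K + 2) = x ^ (i + 2) * x ^ (K - i) := by
      rw [← pow_add]; congr 1; omega
    rw [e, ← two_mul x, mul_pow]
    field_simp
    ring
  rw [Finset.sum_congr rfl key, Finset.sum_const, Finset.card_range, nsmul_eq_mul]
  ring

/-! ### Absolute summability of the kernel -/

/-- The kernel whose iterated sums evaluate the weighted double sums. -/
noncomputable def signedKernel (K : ℕ) (α β : ℂ) (p : ℕ+ × ℕ+) : ℂ :=
  α ^ (p.2 : ℕ) * β ^ (p.1 : ℕ) / (p.1 : ℂ) ^ (K + 1)
    * (((p.2 : ℂ) - p.1)⁻¹ - ((p.2 : ℂ) + p.1)⁻¹)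

lemma norm_eq_one_of_sq_eq_one {α : ℂ} (h : α ^ 2 = 1) : ‖α‖ = 1 := by
  rcases eq_or_eq_neg_of_sq_eq_sq α 1 (by rw [h, one_pow]) with h | h <;> simp [h]

lemma summable_pnat_rpow_inv : Summable fun n : ℕ+ => ((n : ℝ) ^ (3 / 2 : ℝ))⁻¹ :=
  (Real.summable_nat_rpow_inv.2 (by norm_num : (1 : ℝ) < 3 / 2)).comp_injective
    PNat.coe_injective

lemma rpow_three_halves {x : ℝ} (hx : 0 < x) : x ^ (3 / 2 : ℝ) = x * √x := by
  rw [Real.sqrt_eq_rpow, show (3 / 2 : ℝ) = 1 + 1 / 2 by norm_num, Real.rpow_add hx,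
    Real.rpow_one]

/-- The difference of inverses is `2n/((m-n)(m+n))`, and `√(n|m-n|) ≤ m+n` shares the decay of
`1/(m+n)` equally between `n` and `m-n`, leaving a product of two convergent series. -/
lemma inv_mul_sub_inv_add_le {m n : ℝ} (hm : 0 < m) (hn : 0 < n) (hne : m - n ≠ 0) :
    n⁻¹ ^ 2 * |(m - n)⁻¹ - (m + n)⁻¹|
      ≤ 2 * ((n ^ (3 / 2 : ℝ))⁻¹ * (|m - n| ^ (3 / 2 : ℝ))⁻¹) := by
  have hd : 0 < |m - n| := abs_pos.2 hne
  have hs : 0 < m + n := by linarith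
  have e : (m - n)⁻¹ - (m + n)⁻¹ = 2 * n * ((m - n)⁻¹ * (m + n)⁻¹) := by
    field_simp; ring
  rw [e, abs_mul, abs_of_pos (by positivity : 0 < 2 * n), abs_mul, abs_inv, abs_inv,
    abs_of_pos hs,
    rpow_three_halves hn, rpow_three_halves hd]
  have hsq : √n * √|m - n| ≤ m + n := by
    rw [← Real.sqrt_mul hn.le]
    apply Real.sqrt_le_iff.2 ⟨hs.le, ?_⟩
    have : |m - n| ≤ m + n := by rw [abs_le]; constructor <;> linarith
    nlinarith
  have h1 : (m + n)⁻¹ ≤ (√n)⁻¹ * (√|m - n|)⁻¹ := by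
    rw [← mul_inv]
    exact inv_anti₀ (by positivity) hsq
  calc n⁻¹ ^ 2 * (2 * n * (|m - n|⁻¹ * (m + n)⁻¹))
      = 2 * (n⁻¹ * |m - n|⁻¹) * (m + n)⁻¹ := by field_simp
    _ ≤ 2 * (n⁻¹ * |m - n|⁻¹) * ((√n)⁻¹ * (√|m - n|)⁻¹) := by gcongr
    _ = _ := by rw [mul_inv, mul_inv]; ring

lemma summable_signedKernel {K : ℕ} (hK : 1 ≤ K) {α β : ℂ} (hα : α ^ 2 = 1) (hβ : β ^ 2 = 1) :
    Summable (signedKernel K α β) := by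
  -- Here `d = m - n`. At `d = 0` the power term is `0⁻¹ = 0`, so `Pi.single 0 1` provides the bound
  -- on the diagonal.
  have hZ : Summable fun d : ℤ => 2 * (|(d : ℝ)| ^ (3 / 2 : ℝ))⁻¹ + (Pi.single 0 1 : ℤ → ℝ) d := by
    refine Summable.add (Summable.mul_left _ ?_) ?_
    · refine (Real.summable_abs_int_rpow (by norm_num : (1 : ℝ) < 3 / 2)).congr fun d => ?_
      rw [Real.rpow_neg (abs_nonneg _)]
    · exact (hasSum_pi_single 0 (1 : ℝ)).summable
  have hZ0 : ∀ d : ℤ, 0 ≤ 2 * (|(d : ℝ)| ^ (3 / 2 : ℝ))⁻¹ + (Pi.single 0 1 : ℤ → ℝ) d := by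
    intro d
    have : (0 : ℝ) ≤ (Pi.single 0 1 : ℤ → ℝ) d := by
      by_cases h : d = 0 <;> simp [h]
    positivity
  have hprod := summable_pnat_rpow_inv.mul_of_nonneg hZ (fun n => by positivity) hZ0
  have hinj : Function.Injective fun p : ℕ+ × ℕ+ => (p.1, ((p.2 : ℕ) : ℤ) - ((p.1 : ℕ) : ℤ)) := by
    rintro ⟨a, b⟩ ⟨c, d⟩ h
    simp only [Prod.mk.injEq] at h
    obtain ⟨rfl, h⟩ := h
    have : b = d := PNat.coe_injective (by omega)
    rw [this]
  refine Summable.of_norm_bounded (hprod.comp_injective hinj) ?_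
  rintro ⟨n, m⟩
  have hn : (1 : ℝ) ≤ n := by exact_mod_cast n.2
  have hm : (1 : ℝ) ≤ m := by exact_mod_cast m.2
  have hn0 : (0 : ℝ) < n := by linarith
  have e : ‖signedKernel K α β (n, m)‖
      = (n : ℝ)⁻¹ ^ (K + 1) * |((m : ℝ) - n)⁻¹ - ((m : ℝ) + n)⁻¹| := by
    have : (((m : ℂ) - n)⁻¹ - ((m : ℂ) + n)⁻¹)
        = ((((m : ℝ) - n)⁻¹ - ((m : ℝ) + n)⁻¹ : ℝ) : ℂ) := by push_cast; rfl
    simp only [signedKernel]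
    rw [this, norm_mul, norm_div, norm_mul, norm_pow, norm_pow, norm_pow,
      norm_eq_one_of_sq_eq_one hα, norm_eq_one_of_sq_eq_one hβ, Complex.norm_real,
      Complex.norm_natCast, Real.norm_eq_abs]
    simp
  have hpow : (n : ℝ)⁻¹ ^ (K + 1) ≤ (n : ℝ)⁻¹ ^ 2 :=
    pow_le_pow_of_le_one (by positivity) (inv_le_one_of_one_le₀ hn) (by omega)
  rw [e]
  refine (mul_le_mul_of_nonneg_right hpow (abs_nonneg _)).trans ?_
  simp only [Function.comp]
  push_cast
  by_cases h : m = n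
  · subst h
    rw [sub_self, sub_self, abs_zero, Real.zero_rpow (by norm_num)]
    simp only [Pi.single_eq_same, inv_zero, mul_zero, zero_add, zero_sub, mul_one, abs_neg]
    rw [abs_of_pos (by positivity), rpow_three_halves hn0, inv_pow, ← mul_inv]
    apply inv_anti₀ (by positivity)
    have : √(m : ℝ) ≤ m := by
      rw [Real.sqrt_le_left (by linarith)]; nlinarith
    nlinarith [Real.sqrt_nonneg (m : ℝ), mul_pos hn0 hn0]
  · have hne : (m : ℝ) - n ≠ 0 := by
      rw [sub_ne_zero]; exact_mod_cast h
    have hne' : ((m : ℕ) : ℤ) - ((n : ℕ) : ℤ) ≠ 0 := by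
      rw [sub_ne_zero]; exact_mod_cast h
    rw [Pi.single_eq_of_ne hne', add_zero]
    refine (inv_mul_sub_inv_add_le (by linarith) hn0 hne).trans (le_of_eq ?_)
    ring

/-! ### Evaluation of the inner sums -/

lemma tendsto_pow_mul_inv_add {α : ℂ} (hα : α ^ 2 = 1) (c : ℂ) (n : ℕ) :
    Tendsto (fun M : ℕ => α ^ (M + n) * ((M : ℂ) + c)⁻¹) atTop (𝓝 0) := by
  have h : Tendsto (fun M : ℕ => ‖((M : ℂ) + c)⁻¹‖) atTop (𝓝 0) := by
    have h2 : Tendsto (fun M : ℕ => (M : ℂ) + c) atTop (Bornology.cobounded ℂ) :=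
      (tendsto_add_const_cobounded c).comp (tendsto_norm_atTop_iff_cobounded.1
        (by simpa using tendsto_natCast_atTop_atTop (R := ℝ)))
    simpa using (tendsto_inv₀_cobounded.comp h2).norm
  refine squeeze_zero_norm (fun M => ?_) h
  rw [norm_mul, norm_pow, norm_eq_one_of_sq_eq_one hα, one_pow, one_mul]

/-- Passing from `n` to `n + 1` shifts the two progressions by one step in opposite directions; as
`α⁻¹ = α`, both shifts cost the same factor `α`. The boundary terms leave `-α/n + 1/(n+1)` in the
limit, and `-α/n` cancels the induction hypothesis. The convention `0⁻¹ = 0` omits the pole. -/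
lemma tendsto_sum_pow_mul_inv_sub {α : ℂ} (hα : α ^ 2 = 1) (n : ℕ) :
    Tendsto (fun M : ℕ => ∑ m ∈ Finset.range M,
      α ^ (m + 1) * (((m : ℂ) + 1 - n)⁻¹ - ((m : ℂ) + 1 + n)⁻¹)) atTop (𝓝 (n : ℂ)⁻¹) := by
  have hα0 : α * α = 1 := by rw [← sq, hα]
  induction n with
  | zero => simp
  | succ n ih =>
    have step : ∀ M : ℕ, ∑ m ∈ Finset.range M,
        α ^ (m + 1) * (((m : ℂ) + 1 - (n + 1 : ℕ))⁻¹ - ((m : ℂ) + 1 + (n + 1 : ℕ))⁻¹)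
        = α * ∑ m ∈ Finset.range M,
            α ^ (m + 1) * (((m : ℂ) + 1 - n)⁻¹ - ((m : ℂ) + 1 + n)⁻¹)
          + (-α * (n : ℂ)⁻¹ - α ^ (M + 1) * ((M : ℂ) + -n)⁻¹)
          + (((n : ℂ) + 1)⁻¹ - α ^ (M + 0) * ((M : ℂ) + (n + 1))⁻¹) := by
      intro M
      induction M with
      | zero =>
        simp only [Finset.range_zero, Finset.sum_empty, pow_one, pow_zero, zero_add,
          Nat.cast_zero, inv_neg, mul_zero]
        ring
      | succ M ihM =>
        rw [Finset.sum_range_succ, Finset.sum_range_succ, ihM]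
        have e1 : (M : ℂ) + 1 - (n + 1 : ℕ) = M + -n := by push_cast; ring
        have e2 : (M : ℂ) + 1 + (n + 1 : ℕ) = ((M + 1 : ℕ) : ℂ) + (n + 1) := by push_cast; ring
        have e3 : (M : ℂ) + 1 - n = ((M + 1 : ℕ) : ℂ) + -n := by push_cast; ring
        have e4 : (M : ℂ) + 1 + n = M + (n + 1) := by ring
        rw [e1, e2, e3, e4]
        have e5 : α ^ (M + 1 + 1) = α ^ M := by rw [pow_succ, pow_succ, mul_assoc, hα0, mul_one]
        have e6 : α * α ^ (M + 1) = α ^ M := by rw [← e5]; ring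
        simp only [mul_add, ← mul_assoc, e5, e6, add_zero]
        ring
    have lim := ((ih.const_mul α).add
      ((tendsto_pow_mul_inv_add hα (-n) 1).const_sub (-α * (n : ℂ)⁻¹))).add
      ((tendsto_pow_mul_inv_add hα (n + 1) 0).const_sub (((n : ℂ) + 1)⁻¹))
    convert lim.congr fun M => (step M).symm using 2
    push_cast
    ring

lemma hasSum_pow_mul_inv_sub {α : ℂ} (hα : α ^ 2 = 1) (n : ℕ+)
    (hs : Summable fun m : ℕ+ => α ^ (m : ℕ) * (((m : ℂ) - n)⁻¹ - ((m : ℂ) + n)⁻¹)) :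
    HasSum (fun m : ℕ+ => α ^ (m : ℕ) * (((m : ℂ) - n)⁻¹ - ((m : ℂ) + n)⁻¹)) (n : ℂ)⁻¹ := by
  have hs' := (Equiv.pnatEquivNat.symm.summable_iff).2 hs
  have h1 := hs'.hasSum.tendsto_sum_nat
  have h2 := tendsto_sum_pow_mul_inv_sub hα (n : ℕ)
  have e : (fun m : ℕ+ => α ^ (m : ℕ) * (((m : ℂ) - n)⁻¹ - ((m : ℂ) + n)⁻¹))
      ∘ Equiv.pnatEquivNat.symm
      = fun m : ℕ => α ^ (m + 1) * (((m : ℂ) + 1 - (n : ℕ))⁻¹ - ((m : ℂ) + 1 + (n : ℕ))⁻¹) := by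
    funext m
    simp [Equiv.pnatEquivNat]
  rw [e] at h1 hs'
  have h3 := hs'.hasSum
  rw [tendsto_nhds_unique h1 h2, ← e] at h3
  exact (Equiv.pnatEquivNat.symm.hasSum_iff).1 h3

lemma hasSum_signedKernel {K : ℕ} (hK : 1 ≤ K) {α β : ℂ} (hα : α ^ 2 = 1) (hβ : β ^ 2 = 1) :
    HasSum (signedKernel K α β) (∑' n : ℕ+, β ^ (n : ℕ) / (n : ℂ) ^ (K + 2)) := by
  have hs := summable_signedKernel hK hα hβ
  have inner : ∀ n : ℕ+, HasSum (fun m => signedKernel K α β (n, m))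
      (β ^ (n : ℕ) / (n : ℂ) ^ (K + 2)) := by
    intro n
    have hn : (n : ℂ) ≠ 0 := by exact_mod_cast n.ne_zero
    have hβ0 : β ≠ 0 := by rintro rfl; simp at hβ
    have hc : β ^ (n : ℕ) / (n : ℂ) ^ (K + 1) ≠ 0 := by positivity
    have e : (fun m => signedKernel K α β (n, m)) = fun m : ℕ+ => β ^ (n : ℕ) / (n : ℂ) ^ (K + 1) *
        (α ^ (m : ℕ) * (((m : ℂ) - n)⁻¹ - ((m : ℂ) + n)⁻¹)) := by
      funext m
      simp only [signedKernel]
      ring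
    have h1 := hs.prod_factor n
    rw [e] at h1 ⊢
    have h2 := (hasSum_pow_mul_inv_sub hα n ((summable_mul_left_iff hc).1 h1)).mul_left
      (β ^ (n : ℕ) / (n : ℂ) ^ (K + 1))
    rwa [show β ^ (n : ℕ) / (n : ℂ) ^ (K + 2)
      = β ^ (n : ℕ) / (n : ℂ) ^ (K + 1) * (n : ℂ)⁻¹ by rw [pow_succ _ (K + 1)]; field_simp]
  have h := hs.hasSum.prod_fiberwise inner
  rw [h.tsum_eq]
  exact hs.hasSum

lemma summable_pow_div_pow {K : ℕ} {α : ℂ} (hα : α ^ 2 = 1) :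
    Summable fun n : ℕ+ => α ^ (n : ℕ) / (n : ℂ) ^ (K + 2) := by
  have h : Summable fun n : ℕ+ => 1 / ((n : ℕ) : ℝ) ^ (K + 2) :=
    (Real.summable_one_div_nat_pow.2 (by omega : 1 < K + 2)).comp_injective PNat.coe_injective
  refine Summable.of_norm_bounded h fun n => ?_
  rw [norm_div, norm_pow, norm_pow, norm_eq_one_of_sq_eq_one hα, one_pow, Complex.norm_natCast]

lemma hasSum_diagonal {f : ℕ+ → ℂ} {s : ℂ} (h : HasSum f s) :
    HasSum (fun p : ℕ+ × ℕ+ => if p.1 = p.2 then f p.1 else 0) s := by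
  have hinj : Function.Injective fun n : ℕ+ => (n, n) := fun a b h => (Prod.mk.inj h).1
  refine (hinj.hasSum_iff ?_).1 (by simpa [Function.comp_def] using h)
  rintro ⟨a, b⟩ hab
  refine if_neg fun h => hab ⟨a, ?_⟩
  simpa using h

/-! ### Symmetrized double sum -/

/-- The product of signs times the weighted partial fractions, at a pair `(n, m)`. -/
noncomputable def weightedTerm (K : ℕ) (α β : ℂ) (p : ℕ+ × ℕ+) : ℂ :=
  ∑ i ∈ Finset.range K, (2 : ℂ) ^ (i + 1) *
    (α ^ (p.2 : ℕ) * β ^ (p.1 : ℕ) / (((p.2 : ℂ) + p.1) ^ (i + 2) * (p.1 : ℂ) ^ (K - i))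
      + α ^ (p.2 : ℕ) * β ^ (p.1 : ℕ) / (((p.2 : ℂ) + p.1) ^ (i + 2) * (p.2 : ℂ) ^ (K - i)))

/-- On the diagonal each kernel contributes `-1/2` of `(αβ)^n / n^(K+2)`, because `0⁻¹ = 0`, while
the true coefficient is `K`; hence the correction `K + 1`. -/
lemma weightedTerm_eq (K : ℕ) (α β : ℂ) (p : ℕ+ × ℕ+) :
    weightedTerm K α β p = signedKernel K α β p + signedKernel K β α p.swap
      + if p.1 = p.2 then (K + 1) * ((α * β) ^ (p.1 : ℕ) / (p.1 : ℂ) ^ (K + 2)) else 0 := by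
  obtain ⟨n, m⟩ := p
  have hn : (n : ℂ) ≠ 0 := by exact_mod_cast n.ne_zero
  have hm : (m : ℂ) ≠ 0 := by exact_mod_cast m.ne_zero
  have hmn : (m : ℂ) + n ≠ 0 := by exact_mod_cast (m + n).ne_zero
  have e : weightedTerm K α β (n, m) = α ^ (m : ℕ) * β ^ (n : ℕ) *
      ∑ i ∈ Finset.range K, (2 : ℂ) ^ (i + 1) *
        (1 / (((m : ℂ) + n) ^ (i + 2) * (n : ℂ) ^ (K - i))
          + 1 / (((m : ℂ) + n) ^ (i + 2) * (m : ℂ) ^ (K - i))) := by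
    rw [weightedTerm, Finset.mul_sum]
    refine Finset.sum_congr rfl fun i _ => ?_
    ring
  rw [e]
  simp only [signedKernel, Prod.fst_swap, Prod.snd_swap]
  by_cases h : n = m
  · subst h
    rw [sum_two_pow_partialFractions_diag hn, if_pos rfl, sub_self, inv_zero, mul_pow]
    field_simp
    ring
  · have hne : (m : ℂ) - n ≠ 0 := by
      rw [sub_ne_zero]; exact_mod_cast Ne.symm h
    rw [sum_two_pow_partialFractions hm hn hmn hne, if_neg h, add_comm (n : ℂ) m]
    ring

lemma hasSum_weightedTerm {K : ℕ} (hK : 1 ≤ K) {α β : ℂ} (hα : α ^ 2 = 1) (hβ : β ^ 2 = 1) :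
    HasSum (weightedTerm K α β)
      (∑' n : ℕ+, β ^ (n : ℕ) / (n : ℂ) ^ (K + 2) + ∑' n : ℕ+, α ^ (n : ℕ) / (n : ℂ) ^ (K + 2)
        + (K + 1) * ∑' n : ℕ+, (α * β) ^ (n : ℕ) / (n : ℂ) ^ (K + 2)) := by
  have hαβ : (α * β) ^ 2 = 1 := by rw [mul_pow, hα, hβ, one_mul]
  have h2 : HasSum (fun p : ℕ+ × ℕ+ => signedKernel K β α p.swap) _ :=
    ((Equiv.prodComm ℕ+ ℕ+).hasSum_iff).2 (hasSum_signedKernel hK hβ hα)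
  have h3 := hasSum_diagonal
    ((summable_pow_div_pow (K := K) hαβ).hasSum.mul_left ((K : ℂ) + 1))
  rw [funext (weightedTerm_eq K α β)]
  exact ((hasSum_signedKernel hK hα hβ).add h2).add h3

/-! ### Return to alternating double zeta values -/

/-- Pairs of positive integers `(n, m)` correspond to decreasing pairs `(m + n, n)`. -/
def decreasingPairEquiv : ℕ+ × ℕ+ ≃ DecreasingPair where
  toFun p := ⟨((p.2 : ℕ) + p.1, p.1), p.1.pos, Nat.lt_add_of_pos_left p.2.pos⟩
  invFun q := (⟨q.1.2, q.2.1⟩, ⟨q.1.1 - q.1.2, Nat.sub_pos_of_lt q.2.2⟩)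
  left_inv p := by
    refine Prod.ext (PNat.eq rfl) (PNat.eq ?_)
    simp
  right_inv q := by
    have := q.2.2
    refine Subtype.ext (Prod.ext ?_ rfl)
    simp only [PNat.mk_coe]
    omega

/-- The sign attached to a barred or unbarred argument. -/
noncomputable def barSign (a : ZMod 2) : ℂ := (-1) ^ a.val

lemma barSign_sq (a : ZMod 2) : barSign a ^ 2 = 1 := by
  rw [barSign, ← pow_mul, mul_comm, pow_mul]; simp

lemma barSign_add (a b : ZMod 2) : barSign (a + b) = barSign a * barSign b := by
  rw [barSign, barSign, barSign, ← pow_add, ZMod.val_add, ← neg_one_pow_eq_pow_mod_two]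

lemma altZetaTerm_eq (k : ℕ) (a : ZMod 2) (m : ℕ+) :
    altZetaTerm k a m = barSign a ^ (m : ℕ) / (m : ℂ) ^ k := by
  rw [altZetaTerm, barSign, ← pow_mul]

/-- The label `a + b` makes the signs separate: `m₁ = m + n` and `m₂ = n` both contribute `(-1)^(a
n)`, and these cancel. -/
lemma altDoubleZetaTerm_decreasingPairEquiv (j l : ℕ) (a b : ZMod 2) (p : ℕ+ × ℕ+) :
    altDoubleZetaTerm j l a (a + b) (decreasingPairEquiv p)
      = barSign a ^ (p.2 : ℕ) * barSign b ^ (p.1 : ℕ)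
        / (((p.2 : ℂ) + p.1) ^ j * (p.1 : ℂ) ^ l) := by
  have h : (-1 : ℂ) ^ (a.val * ((p.2 : ℕ) + p.1) + (a + b).val * (p.1 : ℕ))
      = barSign a ^ (p.2 : ℕ) * barSign b ^ (p.1 : ℕ) := by
    rw [pow_add, pow_mul, pow_mul]
    change barSign a ^ ((p.2 : ℕ) + p.1) * barSign (a + b) ^ (p.1 : ℕ) = _
    rw [barSign_add, mul_pow, pow_add]
    have : barSign a ^ (p.1 : ℕ) * barSign a ^ (p.1 : ℕ) = 1 := by
      rw [← mul_pow, ← sq, barSign_sq, one_pow]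
    linear_combination barSign a ^ (p.2 : ℕ) * barSign b ^ (p.1 : ℕ) * this
  simp only [altDoubleZetaTerm, decreasingPairEquiv, Equiv.coe_fn_mk]
  rw [h]
  push_cast
  rfl

/-- Since `n ≤ m`, half a power moves from `m` to `n`: `m^(3/2) * n^(3/2) ≤ m^2 * n`, so a product
of two convergent series dominates. -/
lemma summable_altDoubleZetaTerm {j l : ℕ} (hj : 2 ≤ j) (hl : 1 ≤ l) (a b : ZMod 2) :
    Summable (altDoubleZetaTerm j l a b) := by
  have hn := Real.summable_nat_rpow_inv.2 (by norm_num : (1 : ℝ) < 3 / 2)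
  have h := (hn.mul_of_nonneg hn (fun _ => by positivity)
    (fun _ => by positivity)).comp_injective (Subtype.val_injective (p := fun m : ℕ × ℕ =>
      0 < m.2 ∧ m.2 < m.1))
  refine Summable.of_norm_bounded h ?_
  rintro ⟨⟨m, n⟩, h0, h1⟩
  have hn : (1 : ℝ) ≤ n := by exact_mod_cast h0
  have hm : (n : ℝ) ≤ m := by exact_mod_cast (le_of_lt h1 : n ≤ m)
  have hn0 : (0 : ℝ) < n := by linarith
  have hm0 : (0 : ℝ) < m := by linarith
  simp only [altDoubleZetaTerm, Function.comp]
  rw [norm_div, norm_pow, norm_neg, norm_one, one_pow, norm_mul, norm_pow, norm_pow,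
    Complex.norm_natCast, Complex.norm_natCast, one_div, ← mul_inv, rpow_three_halves hm0,
    rpow_three_halves hn0]
  apply inv_anti₀ (by positivity)
  calc (m : ℝ) * √m * (n * √n) ≤ (m : ℝ) * √m * (n * √m) := by gcongr
    _ = (m : ℝ) ^ 2 * n ^ 1 := by
        have := Real.mul_self_sqrt hm0.le
        linear_combination (m : ℝ) * n * this
    _ ≤ (m : ℝ) ^ j * n ^ l := by
        gcongr
        all_goals linarith

lemma hasSum_altDoubleZeta {j l : ℕ} (hj : 2 ≤ j) (hl : 1 ≤ l) (a b : ZMod 2) :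
    HasSum (fun p : ℕ+ × ℕ+ => barSign a ^ (p.2 : ℕ) * barSign b ^ (p.1 : ℕ)
        / (((p.2 : ℂ) + p.1) ^ j * (p.1 : ℂ) ^ l)) (altDoubleZeta j l a (a + b)) := by
  have h := (decreasingPairEquiv.hasSum_iff).2
    (summable_altDoubleZetaTerm hj hl a (a + b)).hasSum
  rwa [funext fun p => (altDoubleZetaTerm_decreasingPairEquiv j l a b p).symm]

/-- The weighted sum formula for alternating double zeta values with arbitrary signs. -/
theorem sum_two_pow_mul_altDoubleZeta {K : ℕ} (hK : 1 ≤ K) (a b : ZMod 2) :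
    ∑ i ∈ Finset.range K, (2 : ℂ) ^ (i + 1) *
        (altDoubleZeta (i + 2) (K - i) a (a + b) + altDoubleZeta (i + 2) (K - i) b (a + b))
      = altZeta (K + 2) a + altZeta (K + 2) b + (K + 1) * altZeta (K + 2) (a + b) := by
  have h1 : HasSum (weightedTerm K (barSign a) (barSign b)) (∑ i ∈ Finset.range K,
      (2 : ℂ) ^ (i + 1) *
        (altDoubleZeta (i + 2) (K - i) a (a + b) + altDoubleZeta (i + 2) (K - i) b (a + b))) := by
    refine hasSum_sum fun i hi => HasSum.mul_left _ (HasSum.add ?_ ?_)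
    · exact hasSum_altDoubleZeta (by omega) (by have := Finset.mem_range.1 hi; omega) a b
    · have h := hasSum_altDoubleZeta (j := i + 2) (l := K - i) (by omega)
        (by have := Finset.mem_range.1 hi; omega) b a
      rw [add_comm b a] at h
      refine Eq.mp (congrArg (HasSum · _) (funext fun p => ?_))
        (((Equiv.prodComm ℕ+ ℕ+).hasSum_iff).2 h)
      simp only [Function.comp, Equiv.prodComm_apply, Prod.fst_swap, Prod.snd_swap]
      rw [mul_comm (barSign a ^ _), add_comm (p.2 : ℂ)]
  have h2 := hasSum_weightedTerm hK (barSign_sq a) (barSign_sq b)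
  rw [h1.unique h2]
  simp only [altZeta, altZetaTerm_eq, barSign_add]
  ring

lemma doubleZeta_eq_altDoubleZeta (j l : ℕ) : doubleZeta j l = altDoubleZeta j l 0 0 := by
  simp [doubleZeta, altDoubleZeta, altDoubleZetaTerm]

lemma altZeta_zero {k : ℕ} (hk : 2 ≤ k) : altZeta k 0 = riemannZeta k := by
  rw [zeta_nat_eq_tsum_of_gt_one (by omega), altZeta]
  simp only [altZetaTerm, ZMod.val_zero, zero_mul, pow_zero]
  exact tsum_pnat_eq_tsum_of_eq_zero (f := fun n : ℕ => 1 / (n : ℂ) ^ k)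
    (by simp [show k ≠ 0 by omega])

lemma sum_Icc_two_eq_sum_range (K : ℕ) (f : ℕ → ℕ → ℂ) :
    ∑ j ∈ Finset.Icc 2 (K + 2 - 1), f j (K + 2 - j)
      = ∑ i ∈ Finset.range K, f (i + 2) (K - i) := by
  have e : Finset.Icc 2 (K + 2 - 1) = Finset.Ico 2 (K + 2) := by
    ext j
    simp only [Finset.mem_Icc, Finset.mem_Ico]
    omega
  rw [e, Finset.sum_Ico_eq_sum_range, Nat.add_sub_cancel]
  refine Finset.sum_congr rfl fun i _ => ?_
  rw [add_comm 2 i, Nat.add_sub_add_right]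

theorem mainTheorem7 (k : ℕ) (hk : 3 ≤ k) :
    -- all the series that occur are (absolutely) convergent
    (∀ j ∈ Finset.Icc 2 (k - 1), ∀ a₁ a₂ : ZMod 2,
      Summable (altDoubleZetaTerm j (k - j) a₁ a₂)) ∧
    (∀ a : ZMod 2, Summable (altZetaTerm k a)) ∧
    -- the three weighted sum formulas
    (∑ j ∈ Finset.Icc 2 (k - 1), (2 : ℂ) ^ j * doubleZeta j (k - j)
      = ((k : ℂ) + 1) * riemannZeta (k : ℂ)) ∧
    (∑ j ∈ Finset.Icc 2 (k - 1), (2 : ℂ) ^ j * altDoubleZeta j (k - j) 0 1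
        + ∑ j ∈ Finset.Icc 2 (k - 1), (2 : ℂ) ^ j * altDoubleZeta j (k - j) 1 1
      = 2 * riemannZeta (k : ℂ) + 2 * (k : ℂ) * altZeta k 1) ∧
    (∑ j ∈ Finset.Icc 2 (k - 1), (2 : ℂ) ^ j * altDoubleZeta j (k - j) 1 0
      = ((k : ℂ) - 1) * riemannZeta (k : ℂ) + 2 * altZeta k 1) := by
  obtain ⟨K, rfl⟩ : ∃ K, k = K + 2 := ⟨k - 2, by omega⟩
  have hK : 1 ≤ K := by omega
  rw [← altZeta_zero (by omega : 2 ≤ K + 2)]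
  have h11 : (1 + 1 : ZMod 2) = 0 := by decide
  have h00 := sum_two_pow_mul_altDoubleZeta hK 0 0
  have h01 := sum_two_pow_mul_altDoubleZeta hK 0 1
  have h10 := sum_two_pow_mul_altDoubleZeta hK 1 1
  rw [zero_add] at h00 h01
  rw [h11] at h10
  refine ⟨fun j hj a b => ?_, fun a => ?_, ?_, ?_, ?_⟩
  · have := Finset.mem_Icc.1 hj
    exact summable_altDoubleZetaTerm this.1 (by omega) a b
  · exact (summable_pow_div_pow (K := K) (barSign_sq a)).congr fun m =>
      (altZetaTerm_eq (K + 2) a m).symm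
  · simp only [doubleZeta_eq_altDoubleZeta]
    rw [sum_Icc_two_eq_sum_range K fun j l => (2 : ℂ) ^ j * altDoubleZeta j l 0 0]
    rw [show (((K + 2 : ℕ) : ℂ) + 1) * altZeta (K + 2) 0 = altZeta (K + 2) 0 + altZeta (K + 2) 0
      + (K + 1) * altZeta (K + 2) 0 by push_cast; ring, ← h00]
    exact Finset.sum_congr rfl fun i _ => by ring
  · rw [sum_Icc_two_eq_sum_range K fun j l => (2 : ℂ) ^ j * altDoubleZeta j l 0 1,
      sum_Icc_two_eq_sum_range K fun j l => (2 : ℂ) ^ j * altDoubleZeta j l 1 1,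
      ← Finset.sum_add_distrib]
    rw [show 2 * altZeta (K + 2) 0 + 2 * ((K + 2 : ℕ) : ℂ) * altZeta (K + 2) 1
      = 2 * (altZeta (K + 2) 0 + altZeta (K + 2) 1 + (K + 1) * altZeta (K + 2) 1)
      by push_cast; ring, ← h01, Finset.mul_sum]
    exact Finset.sum_congr rfl fun i _ => by ring
  · rw [sum_Icc_two_eq_sum_range K fun j l => (2 : ℂ) ^ j * altDoubleZeta j l 1 0]
    rw [show (((K + 2 : ℕ) : ℂ) - 1) * altZeta (K + 2) 0 + 2 * altZeta (K + 2) 1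
      = altZeta (K + 2) 1 + altZeta (K + 2) 1 + (K + 1) * altZeta (K + 2) 0
      by push_cast; ring, ← h10]
    exact Finset.sum_congr rfl fun i _ => by ring
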